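/- For $1<s\le 2$ let $T=T_s:[0,1]\to[0,1]$, $T_s(x)=\min\{sx,\,s(1-x)\}$, be the tent map with critical point $c=\tfrac12$ and $c_k=T^k(c)$, and let $$X'=\{(\dots,x_{-2},x_{-1},x_0): x_{-i}\in[c_2,c_1],\ T(x_{-i-1})=x_{-i}\text{ for all } i\ge 0\}$$ be its core inverse limit space, with the product topology. A continuum is a nonempty compact connected space. A point $x\in X'$ is an endpoint if for any two subcontinua $A,B\subset X'$ containing $x$, either $A\subset B$ or $B\subset A$; let $\mathcal E$ be the set of endpoints of $X'$. A point of $X'$ is a folding point if it has no neighbourhood in $X'$ homeomorphic to the product of a Cantor set and an open arc; let $\mathcal F$ be the set of folding points of $X'$. Let $\mathcal F_0\subset\mathcal F$ be the set of points of $X'$ that have no neighbourhood homeomorphic to the product of a compact zero-dimensional (compact, Hausdorff, totally disconnected) space and an open arc. Suppose that the orbit $\{T^n(c):n\ge 0\}$ is infinite and that $c$ is recurrent, i.e. $c\in\omega(c)$. Then $X'$ has uncountably many endpoints. Moreover, $\mathcal E$ has no isolated points, and $\mathcal E$ is dense in $\mathcal F_0$, that is, $\mathcal E\subset\mathcal F_0\subset\overline{\mathcal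 E}$. If $s>\sqrt2$, then $\mathcal E$ is dense in $\mathcal F$, that is, $\mathcal E\subset\mathcal F\subset\overline{\mathcal E}$. -/

import Mathlib

open Set Filter Topology

/-- The tent map `T_s(x) = min {s x, s (1 - x)}`. -/
noncomputable def tentMap (s x : ℝ) : ℝ := min (s * x) (s * (1 - x))

/-- The critical point `c = 1/2` of every tent map. -/
noncomputable def critPt : ℝ := 1 / 2

/-- The forward orbit `{x, f x, f² x, …}`. -/
def forwardOrbit {α : Type*} (f : α → α) (x : α) : Set α :=
  Set.range fun n : ℕ => f^[n] x

/-- `x` is recurrent if it belongs to its own omega-limit set. -/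
def IsRecurrentPt {α : Type*} [TopologicalSpace α] (f : α → α) (x : α) : Prop :=
  x ∈ omegaLimit atTop (fun (n : ℕ) (y : α) => f^[n] y) {x}

/-- The core `[c₂, c₁] = [T²(c), T(c)]`. -/
def tentCore (s : ℝ) : Set ℝ := Icc (tentMap s (tentMap s critPt)) (tentMap s critPt)

/-- The core inverse limit space: all backward orbits of `T_s` in the core. The entry `x i` is the
coordinate `π_i(x) = x_{-i}`. As a type it carries the subspace topology of the product topology on
`ℕ → ℝ`, which is the topology of the metric `∑ 2⁻ⁱ |x_{-i} - y_{-i}|`. -/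
def coreInverseLimit (s : ℝ) : Set (ℕ → ℝ) :=
  {x | ∀ i : ℕ, x i ∈ tentCore s ∧ tentMap s (x (i + 1)) = x i}

/-- A subcontinuum: a nonempty, compact, connected subset
(`IsConnected` includes nonemptiness). -/
def IsSubcontinuum {Y : Type*} [TopologicalSpace Y] (A : Set Y) : Prop :=
  IsCompact A ∧ IsConnected A

/-- The set of endpoints: points `x` such that any two subcontinua containing `x` are nested. -/
def endpoints (Y : Type*) [TopologicalSpace Y] : Set Y :=
  {x | ∀ A B : Set Y, IsSubcontinuum A → IsSubcontinuum B → x ∈ A → x ∈ B → A ⊆ B ∨ B ⊆ A}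

/-- The set of folding points: points without a neighbourhood homeomorphic to the product of the
Cantor set (here `ℕ → Bool`) and an open arc. -/
def foldingPoints (Y : Type*) [TopologicalSpace Y] : Set Y :=
  {x | ¬ ∃ U ∈ 𝓝 x, Nonempty (U ≃ₜ (ℕ → Bool) × Ioo (0 : ℝ) 1)}

/-- The variant of folding points in which the Cantor set may be replaced by any compact
zero-dimensional (i.e. compact Hausdorff totally disconnected) space: points without a
neighbourhood homeomorphic to the product of such a space and an open arc. (There is no loss in
taking `Z` in the universe of `Y`, because `Z` embeds in `Y`.) -/
def wideFoldingPoints.{u} (Y : Type u) [TopologicalSpace Y] : Set Y :=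
  {x | ¬ ∃ U ∈ 𝓝 x, ∃ (Z : Type u) (_ : TopologicalSpace Z),
    CompactSpace Z ∧ T2Space Z ∧ TotallyDisconnectedSpace Z ∧
      Nonempty (U ≃ₜ Z × Ioo (0 : ℝ) 1)}

/-! ### Backward orbits -/

section Backward

variable {α : Type*} {f : α → α} {b : ℕ → α}

/-! Everything is compared with the set L of backward orbits lying in the closure of the critical
orbit (`postcriticalLimit`). Recurrence makes `T` surjective on that closure, and with infinitude of
the orbit it makes L compact and perfect. A point whose coordinates satisfy liminf sⁿ|x₋ₙ - c| = 0
is an endpoint (`mem_endpoints_of_close_critPt`): near the maximum of `T`, the projections of two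
subcontinua through it are almost nested intervals. In L such points form a dense Gδ, so by Baire
endpoints accumulate at every point of L even after a countable set C is deleted
(`postcriticalLimit_subset_closure_endpoints_diff`). Conversely, an endpoint is never interior to an
arc, so it is a folding point. A point with a coordinate off the closed critical orbit has a
neighbourhood that is admissible itineraries times an arc, so folding points lie in L. If s > √2,
the itinerary space is a Cantor set, which handles the narrower notion. -/

theorem iterate_backward (hb : ∀ k, f (b (k + 1)) = b k) (n k : ℕ) : f^[n] (b (n + k)) = b k := by
  induction n with
  | zero => simp
  | succ n ih => rw [Function.iterate_succ_apply, Nat.add_right_comm, hb, ih]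

theorem iterate_backward_succ (hb : ∀ k, f (b (k + 1)) = b k) (n k : ℕ) :
    f (f^[n] (b (k + 1))) = f^[n] (b k) := by
  rw [← Function.iterate_succ_apply' f, Function.iterate_succ_apply, hb]

end Backward

/-! ### The tent map, its core and the closed critical orbit -/

section Tent

variable {s : ℝ}

theorem continuous_tentMap (s : ℝ) : Continuous (tentMap s) := by
  unfold tentMap; fun_prop

theorem tentMap_of_le {x : ℝ} (hs : 0 ≤ s) (hx : x ≤ 1 / 2) : tentMap s x = s * x := by
  unfold tentMap; apply min_eq_left; nlinarith

theorem tentMap_of_ge {x : ℝ} (hs : 0 ≤ s) (hx : 1 / 2 ≤ x) : tentMap s x = s * (1 - x) := by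
  unfold tentMap; apply min_eq_right; nlinarith

theorem tentMap_eq (hs : 0 ≤ s) (x : ℝ) : tentMap s x = s / 2 - s * |x - critPt| := by
  unfold critPt
  rcases le_total x (1 / 2) with h | h
  · rw [tentMap_of_le hs h, abs_of_nonpos (by linarith)]; ring
  · rw [tentMap_of_ge hs h, abs_of_nonneg (by linarith)]; ring

theorem tentMap_critPt (hs : 0 ≤ s) : tentMap s critPt = s / 2 := by
  simp [tentMap_eq hs]

theorem abs_tentMap_sub_le (hs : 0 ≤ s) (x y : ℝ) :
    |tentMap s x - tentMap s y| ≤ s * |x - y| := by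
  have h := abs_abs_sub_abs_le (y - critPt) (x - critPt)
  rw [tentMap_eq hs, tentMap_eq hs,
    show s / 2 - s * |x - critPt| - (s / 2 - s * |y - critPt|)
      = s * (|y - critPt| - |x - critPt|) by ring, abs_mul, abs_of_nonneg hs, abs_sub_comm x y]
  refine mul_le_mul_of_nonneg_left (h.trans_eq ?_) hs
  congr 1; ring

theorem abs_tentMap_iterate_sub_le (hs : 0 ≤ s) (n : ℕ) (x y : ℝ) :
    |(tentMap s)^[n] x - (tentMap s)^[n] y| ≤ s ^ n * |x - y| := by
  induction n with
  | zero => simp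
  | succ n ih =>
    rw [Function.iterate_succ_apply', Function.iterate_succ_apply', pow_succ', mul_assoc]
    exact (abs_tentMap_sub_le hs _ _).trans (mul_le_mul_of_nonneg_left ih hs)

theorem tentCore_eq (hs : 1 ≤ s) : tentCore s = Icc (s * (1 - s / 2)) (s / 2) := by
  rw [tentCore, tentMap_critPt (by linarith), tentMap_of_ge (by linarith) (by linarith)]

theorem critPt_mem_tentCore (hs : 1 ≤ s) : critPt ∈ tentCore s := by
  rw [tentCore_eq hs, critPt]
  constructor <;> nlinarith [sq_nonneg (s - 1)]

theorem tentMap_mem_tentCore (hs₁ : 1 ≤ s) (hs₂ : s ≤ 2) {x : ℝ} (hx : x ∈ tentCore s) :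
    tentMap s x ∈ tentCore s := by
  rw [tentCore_eq hs₁] at *
  obtain ⟨h1, h2⟩ := hx
  rcases le_total x (1 / 2) with h | h
  · rw [tentMap_of_le (by linarith) h]
    constructor <;> nlinarith [mul_nonneg (sub_nonneg.2 hs₁) (sub_nonneg.2 hs₂)]
  · rw [tentMap_of_ge (by linarith) h]
    constructor <;> nlinarith

theorem iterate_tentMap_mem_tentCore (hs₁ : 1 ≤ s) (hs₂ : s ≤ 2) {x : ℝ} (hx : x ∈ tentCore s)
    (n : ℕ) : (tentMap s)^[n] x ∈ tentCore s := by
  induction n with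
  | zero => exact hx
  | succ n ih => rw [Function.iterate_succ_apply']; exact tentMap_mem_tentCore hs₁ hs₂ ih

/-- The closure of the critical orbit; it is `ω(c)` when `c` is recurrent. -/
def postcriticalSet (s : ℝ) : Set ℝ := closure (forwardOrbit (tentMap s) critPt)

theorem iterate_critPt_mem_postcriticalSet (s : ℝ) (n : ℕ) :
    (tentMap s)^[n] critPt ∈ postcriticalSet s := subset_closure ⟨n, rfl⟩

theorem critPt_mem_postcriticalSet (s : ℝ) : critPt ∈ postcriticalSet s :=
  iterate_critPt_mem_postcriticalSet s 0

theorem postcriticalSet_subset_tentCore (hs₁ : 1 ≤ s) (hs₂ : s ≤ 2) :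
    postcriticalSet s ⊆ tentCore s := by
  refine closure_minimal ?_ isClosed_Icc
  rintro _ ⟨n, rfl⟩
  exact iterate_tentMap_mem_tentCore hs₁ hs₂ (critPt_mem_tentCore hs₁) n

theorem isCompact_postcriticalSet (hs₁ : 1 ≤ s) (hs₂ : s ≤ 2) : IsCompact (postcriticalSet s) :=
  isCompact_Icc.of_isClosed_subset isClosed_closure (postcriticalSet_subset_tentCore hs₁ hs₂)

theorem IsRecurrentPt.exists_dist_lt {α : Type*} [PseudoMetricSpace α] {f : α → α} {x : α}
    (h : IsRecurrentPt f x) {ε : ℝ} (hε : 0 < ε) (N : ℕ) : ∃ n ≥ N, dist (f^[n] x) x < ε := by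
  rw [IsRecurrentPt, mem_omegaLimit_singleton_iff_mapClusterPt] at h
  exact (frequently_atTop.1 (h.frequently (Metric.ball_mem_nhds x hε))) N

/-- Recurrence makes c a limit of its own late iterates; applying `T^k` transfers this to every c_k.
-/
theorem postcriticalSet_subset_closure_tail (hrec : IsRecurrentPt (tentMap s) critPt) (N : ℕ) :
    postcriticalSet s ⊆ closure {y | ∃ n ≥ N, y = (tentMap s)^[n] critPt} := by
  refine closure_minimal ?_ isClosed_closure
  rintro _ ⟨k, rfl⟩
  have hc : critPt ∈ closure {y | ∃ n ≥ N, y = (tentMap s)^[n] critPt} := by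
    rw [Metric.mem_closure_iff]
    intro ε hε
    obtain ⟨n, hn, h⟩ := hrec.exists_dist_lt hε N
    exact ⟨_, ⟨n, hn, rfl⟩, by rwa [dist_comm]⟩
  refine map_mem_closure ((continuous_tentMap s).iterate k) hc ?_
  rintro _ ⟨n, hn, rfl⟩
  exact ⟨k + n, by omega, (Function.iterate_add_apply ..).symm⟩

theorem exists_tentMap_eq_of_mem_postcriticalSet (hs₁ : 1 ≤ s) (hs₂ : s ≤ 2)
    (hrec : IsRecurrentPt (tentMap s) critPt) {z : ℝ} (hz : z ∈ postcriticalSet s) :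
    ∃ w ∈ postcriticalSet s, tentMap s w = z := by
  have hcl : IsClosed (tentMap s '' postcriticalSet s) :=
    ((isCompact_postcriticalSet hs₁ hs₂).image (continuous_tentMap s)).isClosed
  refine closure_minimal ?_ hcl (postcriticalSet_subset_closure_tail hrec 1 hz)
  rintro _ ⟨n, hn, rfl⟩
  obtain ⟨m, rfl⟩ := Nat.exists_eq_add_of_le' hn
  exact ⟨_, iterate_critPt_mem_postcriticalSet s m, (Function.iterate_succ_apply' ..).symm⟩

theorem injective_iterate_of_infinite {α : Type*} {f : α → α} {x : α}
    (h : (forwardOrbit f x).Infinite) : Function.Injective fun n : ℕ => f^[n] x := by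
  by_contra hinj
  obtain ⟨m, n, hmn, hlt⟩ : ∃ m n, f^[m] x = f^[n] x ∧ m < n := by
    simp only [Function.Injective, not_forall] at hinj
    obtain ⟨m, n, h, hne⟩ := hinj
    rcases lt_or_gt_of_ne hne with hlt | hlt
    exacts [⟨m, n, h, hlt⟩, ⟨n, m, h.symm, hlt⟩]
  refine h (((finite_Iio n).image fun k => f^[k] x).subset ?_)
  rintro _ ⟨k, rfl⟩
  induction k using Nat.strong_induction_on with
  | _ k ih =>
    rcases lt_or_ge k n with hk | hk
    · exact ⟨k, hk, rfl⟩
    · obtain ⟨d, rfl⟩ := Nat.exists_eq_add_of_le hk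
      have : f^[n + d] x = f^[m + d] x := by
        rw [add_comm, Function.iterate_add_apply, ← hmn, ← Function.iterate_add_apply, add_comm]
      simpa only [this] using ih (m + d) (by omega)

theorem exists_ne_mem_postcriticalSet (hinf : (forwardOrbit (tentMap s) critPt).Infinite)
    (hrec : IsRecurrentPt (tentMap s) critPt) {z : ℝ} (hz : z ∈ postcriticalSet s)
    {ε : ℝ} (hε : 0 < ε) : ∃ w ∈ postcriticalSet s, w ≠ z ∧ |w - z| < ε := by
  have key (N : ℕ) : ∃ n ≥ N, |(tentMap s)^[n] critPt - z| < ε := by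
    obtain ⟨_, ⟨n, hn, rfl⟩, h⟩ :=
      Metric.mem_closure_iff.1 (postcriticalSet_subset_closure_tail hrec N hz) ε hε
    exact ⟨n, hn, by rwa [dist_comm, Real.dist_eq] at h⟩
  obtain ⟨n, -, hn⟩ := key 0
  obtain ⟨m, hm, hm'⟩ := key (n + 1)
  by_cases h : (tentMap s)^[n] critPt = z
  · refine ⟨_, iterate_critPt_mem_postcriticalSet s m, fun h' => ?_, hm'⟩
    have := injective_iterate_of_infinite hinf (h.trans h'.symm)
    omega
  · exact ⟨_, iterate_critPt_mem_postcriticalSet s n, h, hn⟩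

end Tent

/-! ### A sufficient condition for endpoints, and Baire category in the postcritical limit -/

section Endpoints

variable {s : ℝ}

theorem iterate_tentMap_apply (x : coreInverseLimit s) (n k : ℕ) :
    (tentMap s)^[n] (x.1 (n + k)) = x.1 k :=
  iterate_backward (fun i => (x.2 i).2) n k

theorem iterate_tentMap_apply_of_le (x : coreInverseLimit s) {j n : ℕ} (h : j ≤ n) :
    (tentMap s)^[n - j] (x.1 n) = x.1 j := by
  simpa only [Nat.sub_add_cancel h] using iterate_tentMap_apply x (n - j) j

theorem continuous_coord (n : ℕ) : Continuous fun x : coreInverseLimit s => x.1 n :=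
  (continuous_apply n).comp continuous_subtype_val

/-- In the inverse limit, a single coordinate controls a basis of neighbourhoods. -/
theorem exists_coord_of_mem_nhds {x : coreInverseLimit s} {U : Set (coreInverseLimit s)}
    (hU : U ∈ 𝓝 x) : ∃ (N : ℕ) (ε : ℝ), 0 < ε ∧
      ∀ y : coreInverseLimit s, |y.1 N - x.1 N| < ε → y ∈ U := by
  obtain ⟨V, hV, hVU⟩ := mem_nhds_subtype _ _ _ |>.1 hU
  rw [nhds_pi, Filter.mem_pi] at hV
  obtain ⟨I, hI, t, ht, hIt⟩ := hV
  obtain ⟨N, hN⟩ := hI.bddAbove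
  have hW : (⋂ i ∈ I, (tentMap s)^[N - i] ⁻¹' t i) ∈ 𝓝 (x.1 N) := by
    refine (biInter_mem hI).2 fun i hi => ?_
    refine ((continuous_tentMap s).iterate _).continuousAt.preimage_mem_nhds ?_
    rw [iterate_tentMap_apply_of_le x (hN hi)]
    exact ht i
  obtain ⟨ε, hε, hball⟩ := Metric.mem_nhds_iff.1 hW
  refine ⟨N, ε, hε, fun y hy => hVU (hIt fun i hi => ?_)⟩
  have := mem_iInter₂.1 (hball (show y.1 N ∈ Metric.ball _ ε from hy)) i hi
  rwa [mem_preimage, iterate_tentMap_apply_of_le y (hN hi)] at this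

/-- Two connected sets through a point whose coordinate is close to `c` have coordinate
projections that are nearly nested, since both project close to the maximum `c₁` one step later. -/
theorem exists_close_of_le (hs : 0 ≤ s) {A B : Set (coreInverseLimit s)}
    {x : coreInverseLimit s} (hB : IsPreconnected B) (hxB : x ∈ B) {n : ℕ}
    (hle : ∃ b ∈ B, ∀ z ∈ A, b.1 n ≤ z.1 n) {z : coreInverseLimit s} (hz : z ∈ A) :
    ∃ b ∈ B, |z.1 n - b.1 n| ≤ s * |x.1 (n + 1) - critPt| := by
  obtain ⟨b, hb, hbA⟩ := hle
  rcases le_total (z.1 n) (x.1 n) with h | h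
  · have hconn := (hB.image _ (continuous_coord n).continuousOn).ordConnected
    obtain ⟨b', hb', he⟩ :=
      hconn.out (mem_image_of_mem _ hb) (mem_image_of_mem _ hxB) ⟨hbA z hz, h⟩
    refine ⟨b', hb', ?_⟩
    simp only at he
    rw [he, sub_self, abs_zero]
    positivity
  -- Here x₋ₙ ≤ z₋ₙ ≤ c₁, and x₋ₙ falls short of c₁ by exactly s|x₋ₙ₋₁ - c|.
  · refine ⟨x, hxB, ?_⟩
    rw [abs_of_nonneg (sub_nonneg.2 h), ← (x.2 n).2, ← (z.2 n).2, tentMap_eq hs, tentMap_eq hs]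
    have : 0 ≤ s * |z.1 (n + 1) - critPt| := by positivity
    linarith

/-- Every point of `A` is close to a point of `B` in the first coordinates. -/
def CloseInto (A B : Set (coreInverseLimit s)) (k : ℕ) : Prop :=
  ∀ z ∈ A, ∃ b ∈ B, ∀ j ≤ k, |z.1 j - b.1 j| < 1 / ((k : ℝ) + 1)

theorem CloseInto.mono {A B : Set (coreInverseLimit s)} {k l : ℕ} (hkl : k ≤ l)
    (h : CloseInto A B l) : CloseInto A B k := fun z hz => by
  obtain ⟨b, hb, hj⟩ := h z hz
  exact ⟨b, hb, fun j hjk => (hj j (hjk.trans hkl)).trans_le (Nat.one_div_le_one_div hkl)⟩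

theorem subset_of_closeInto {A B : Set (coreInverseLimit s)} (hB : IsClosed B)
    (h : ∀ k, CloseInto A B k) : A ⊆ B := fun z hz => by
  choose b hb hbj using fun k => h k z hz
  refine hB.mem_of_tendsto (b := atTop) (f := b) ?_ (Eventually.of_forall hb)
  rw [tendsto_subtype_rng, tendsto_pi_nhds]
  intro j
  rw [tendsto_iff_dist_tendsto_zero]
  refine squeeze_zero' (Eventually.of_forall fun _ => dist_nonneg) ?_
    tendsto_one_div_add_atTop_nhds_zero_nat
  filter_upwards [eventually_ge_atTop j] with k hk
  rw [dist_comm]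
  exact (hbj k j hk).le

/-- The error at level n is at most s|x₋ₙ₋₁ - c|, and descending to level j multiplies it by at most
s^(n-j). -/
theorem closeInto_of_le (hs : 1 ≤ s) {A B : Set (coreInverseLimit s)}
    {x : coreInverseLimit s} (hB : IsPreconnected B) (hxB : x ∈ B) {n k : ℕ} (hkn : k ≤ n)
    (hx : s ^ (n + 1) * |x.1 (n + 1) - critPt| < 1 / ((k : ℝ) + 1))
    (hle : ∃ b ∈ B, ∀ z ∈ A, b.1 n ≤ z.1 n) : CloseInto A B k := fun z hz => by
  have hs0 : 0 ≤ s := by linarith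
  obtain ⟨b, hb, hzb⟩ := exists_close_of_le hs0 hB hxB hle hz
  refine ⟨b, hb, fun j hj => lt_of_le_of_lt ?_ hx⟩
  rw [← iterate_tentMap_apply_of_le z (hj.trans hkn), ← iterate_tentMap_apply_of_le b (hj.trans hkn)]
  calc _ ≤ s ^ (n - j) * |z.1 n - b.1 n| := abs_tentMap_iterate_sub_le hs0 _ _ _
    _ ≤ s ^ n * (s * |x.1 (n + 1) - critPt|) := by gcongr; exact Nat.sub_le _ _
    _ = _ := by ring

/-- At each good level, the continuum whose projection reaches lower nearly contains the other. One
direction must persist at all precisions, and closedness turns it into inclusion. -/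
theorem mem_endpoints_of_close_critPt (hs : 1 ≤ s) {x : coreInverseLimit s}
    (h : ∀ ε > 0, ∀ k : ℕ, ∃ n > k, s ^ n * |x.1 n - critPt| < ε) :
    x ∈ endpoints (coreInverseLimit s) := by
  intro A B hA hB hxA hxB
  have key (k : ℕ) : CloseInto A B k ∨ CloseInto B A k := by
    obtain ⟨n, hn, hxn⟩ := h (1 / ((k : ℝ) + 1)) (by positivity) k
    obtain ⟨n, rfl⟩ := Nat.exists_eq_add_of_le' (show 1 ≤ n by omega)
    obtain ⟨a, ha, haA⟩ := hA.1.exists_isMinOn hA.2.nonempty (continuous_coord n).continuousOn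
    obtain ⟨b, hb, hbB⟩ := hB.1.exists_isMinOn hB.2.nonempty (continuous_coord n).continuousOn
    rcases le_total (b.1 n) (a.1 n) with hab | hab
    · exact .inl (closeInto_of_le hs hB.2.isPreconnected hxB (by omega) hxn
        ⟨b, hb, fun z hz => hab.trans (haA hz)⟩)
    · exact .inr (closeInto_of_le hs hA.2.isPreconnected hxA (by omega) hxn
        ⟨a, ha, fun z hz => hab.trans (hbB hz)⟩)
  by_cases hAB : ∀ k, CloseInto A B k
  · exact .inl (subset_of_closeInto hB.1.isClosed hAB)
  · push Not at hAB
    obtain ⟨k, hk⟩ := hAB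
    refine .inr (subset_of_closeInto hA.1.isClosed fun l => ?_)
    rcases key (max k l) with h | h
    -- Closeness at a finer precision implies it at a coarser one, so a failure at k excludes this
    -- direction from then on.
    · exact absurd (h.mono (le_max_left _ _)) hk
    · exact h.mono (le_max_right _ _)

/-- The points of the inverse limit all of whose coordinates lie in the closure of the critical
orbit. -/
def postcriticalLimit (s : ℝ) : Set (coreInverseLimit s) := {x | ∀ i, x.1 i ∈ postcriticalSet s}

theorem isClosed_postcriticalLimit (s : ℝ) : IsClosed (postcriticalLimit s) := by
  rw [postcriticalLimit, ofPred_forall]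
  exact isClosed_iInter fun i => isClosed_closure.preimage (continuous_coord i)

theorem isCompact_coreInverseLimit (s : ℝ) : IsCompact (coreInverseLimit s) := by
  refine (isCompact_univ_pi fun _ : ℕ => isCompact_Icc).of_isClosed_subset ?_
    (fun x hx i _ => (hx i).1)
  rw [coreInverseLimit, ofPred_forall]
  refine isClosed_iInter fun i => (isClosed_Icc.preimage (continuous_apply i)).inter ?_
  exact isClosed_eq ((continuous_tentMap s).comp (continuous_apply (i + 1))) (continuous_apply i)

instance (s : ℝ) : CompactSpace (coreInverseLimit s) :=
  isCompact_iff_compactSpace.1 (isCompact_coreInverseLimit s)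

instance (s : ℝ) : CompactSpace (postcriticalLimit s) :=
  isCompact_iff_compactSpace.1 (isClosed_postcriticalLimit s).isCompact

theorem exists_mem_postcriticalLimit (hs₁ : 1 ≤ s) (hs₂ : s ≤ 2)
    (hrec : IsRecurrentPt (tentMap s) critPt) {z : ℝ} (hz : z ∈ postcriticalSet s) (n : ℕ) :
    ∃ x ∈ postcriticalLimit s, x.1 n = z := by
  choose p hp using fun w : postcriticalSet s =>
    (exists_tentMap_eq_of_mem_postcriticalSet hs₁ hs₂ hrec w.2)
  let g : postcriticalSet s → postcriticalSet s := fun w => ⟨p w, (hp w).1⟩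
  let b : ℕ → ℝ := fun k => (g^[k] ⟨z, hz⟩ : postcriticalSet s)
  have hb (k : ℕ) : tentMap s (b (k + 1)) = b k := by
    simp only [b, Function.iterate_succ_apply']
    exact (hp _).2
  have hmem (m k : ℕ) : (tentMap s)^[m] (b k) ∈ postcriticalSet s := by
    refine map_mem_closure ((continuous_tentMap s).iterate m)
      (g^[k] ⟨z, hz⟩ : postcriticalSet s).2 ?_
    rintro _ ⟨j, rfl⟩
    exact ⟨m + j, Function.iterate_add_apply ..⟩
  -- The backward orbit `b` starts at z; applying `T^n` moves z from coordinate 0 to coordinate n.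
  refine ⟨⟨fun j => (tentMap s)^[n] (b j), fun j => ⟨?_, iterate_backward_succ hb n j⟩⟩,
    fun j => hmem n j, iterate_backward hb n 0⟩
  exact postcriticalSet_subset_tentCore hs₁ hs₂ (hmem n j)

theorem exists_coord_of_mem_nhds_postcriticalLimit {x : postcriticalLimit s}
    {U : Set (postcriticalLimit s)} (hU : U ∈ 𝓝 x) : ∃ (N : ℕ) (ε : ℝ), 0 < ε ∧
      ∀ y : postcriticalLimit s, |y.1.1 N - x.1.1 N| < ε → y ∈ U := by
  obtain ⟨V, hV, hVU⟩ := mem_nhds_subtype _ _ _ |>.1 hU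
  obtain ⟨N, ε, hε, h⟩ := exists_coord_of_mem_nhds hV
  exact ⟨N, ε, hε, fun y hy => hVU (h y.1 hy)⟩

theorem perfectSpace_postcriticalLimit (hs₁ : 1 ≤ s) (hs₂ : s ≤ 2)
    (hinf : (forwardOrbit (tentMap s) critPt).Infinite)
    (hrec : IsRecurrentPt (tentMap s) critPt) : PerfectSpace (postcriticalLimit s) := by
  refine ⟨preperfect_iff_nhds.2 fun x _ U hU => ?_⟩
  obtain ⟨N, ε, hε, h⟩ := exists_coord_of_mem_nhds_postcriticalLimit hU
  obtain ⟨w, hw, hne, hlt⟩ := exists_ne_mem_postcriticalSet hinf hrec (x.2 N) hε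
  obtain ⟨y, hy, rfl⟩ := exists_mem_postcriticalLimit hs₁ hs₂ hrec hw N
  exact ⟨⟨y, hy⟩, ⟨h ⟨y, hy⟩ hlt, trivial⟩, fun he => hne (by rw [← he])⟩

theorem dense_close_critPt (hs₁ : 1 ≤ s) (hs₂ : s ≤ 2)
    (hrec : IsRecurrentPt (tentMap s) critPt) {ε : ℝ} (hε : 0 < ε) (k : ℕ) :
    Dense {x : postcriticalLimit s | ∃ n > k, s ^ n * |x.1.1 n - critPt| < ε} := by
  intro x
  rw [mem_closure_iff_nhds]
  intro U hU
  obtain ⟨N, δ, hδ, h⟩ := exists_coord_of_mem_nhds_postcriticalLimit hU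
  obtain ⟨_, ⟨m, hm, rfl⟩, hlt⟩ :=
    Metric.mem_closure_iff.1 (postcriticalSet_subset_closure_tail hrec (k + 1) (x.2 N)) δ hδ
  -- Placing c itself at coordinate m + N makes coordinate N equal to c_m, which is close to that of
  -- x, and makes the distance to c vanish.
  obtain ⟨y, hy, hyc⟩ :=
    exists_mem_postcriticalLimit hs₁ hs₂ hrec (critPt_mem_postcriticalSet s) (m + N)
  refine ⟨⟨y, hy⟩, h ⟨y, hy⟩ ?_, m + N, by omega, ?_⟩
  · simp only
    rwa [← iterate_tentMap_apply y m N, hyc, ← Real.dist_eq, dist_comm]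
  · simpa [hyc] using hε

theorem isOpen_close_critPt (ε : ℝ) (k : ℕ) :
    IsOpen {x : postcriticalLimit s | ∃ n > k, s ^ n * |x.1.1 n - critPt| < ε} := by
  simp only [ofPred_exists, ofPred_and]
  refine isOpen_iUnion fun n => isOpen_const.inter (isOpen_lt ?_ continuous_const)
  have := (continuous_coord (s := s) n).comp (continuous_subtype_val (p := (· ∈ postcriticalLimit s)))
  exact continuous_const.mul ((this.sub continuous_const).abs)

/-- Endpoints are dense in the postcritical limit, even after removing countably many points. -/
theorem postcriticalLimit_subset_closure_endpoints_diff (hs₁ : 1 ≤ s) (hs₂ : s ≤ 2)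
    (hinf : (forwardOrbit (tentMap s) critPt).Infinite)
    (hrec : IsRecurrentPt (tentMap s) critPt) {C : Set (coreInverseLimit s)} (hC : C.Countable) :
    postcriticalLimit s ⊆ closure (endpoints (coreInverseLimit s) \ C) := by
  intro x hx
  have := perfectSpace_postcriticalLimit hs₁ hs₂ hinf hrec
  have := hC.to_subtype
  -- Two countable families of dense open sets: closeness to c at precision 1/(k+1), and complements
  -- of points of C, dense by perfectness.
  let F : ℕ ⊕ C → Set (postcriticalLimit s) :=
    Sum.elim (fun k => {x | ∃ n > k, s ^ n * |x.1.1 n - critPt| < 1 / ((k : ℝ) + 1)})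
      (fun c => {y | y.1 ≠ c.1})
  have hopen (i) : IsOpen (F i) := by
    rcases i with k | c
    · exact isOpen_close_critPt _ _
    · exact isOpen_ne_fun continuous_subtype_val continuous_const
  have hdense (i) : Dense (F i) := by
    rcases i with k | c
    · exact dense_close_critPt hs₁ hs₂ hrec (by positivity) _
    · by_cases hc : c.1 ∈ postcriticalLimit s
      · convert dense_compl_singleton (⟨c.1, hc⟩ : postcriticalLimit s) using 1
        ext y
        simp [F, Subtype.ext_iff]
      · convert dense_univ (X := postcriticalLimit s)
        rw [eq_univ_iff_forall]
        exact fun y hy => hc (hy ▸ y.2)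
  have hx' : (⟨x, hx⟩ : postcriticalLimit s) ∈ closure (⋂ i, F i) :=
    dense_iInter_of_isOpen hopen hdense _
  refine map_mem_closure continuous_subtype_val hx' fun y hy => ⟨?_, fun hyC => ?_⟩
  · refine mem_endpoints_of_close_critPt hs₁ fun ε hε k => ?_
    obtain ⟨m, hm⟩ := exists_nat_one_div_lt hε
    obtain ⟨n, hn, hlt⟩ : ∃ n > max k m, _ := mem_iInter.1 hy (.inl (max k m))
    refine ⟨n, (le_max_left _ _).trans_lt hn, hlt.trans (lt_of_le_of_lt ?_ hm)⟩
    exact Nat.one_div_le_one_div (le_max_right k m)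
  · exact mem_iInter.1 hy (.inr ⟨y, hyC⟩) rfl

end Endpoints

/-! ### Endpoints are not interior to arcs -/

section Arcs

variable {Y : Type*} [TopologicalSpace Y]

theorem not_mem_endpoints_of_arc {γ : Ioo (0 : ℝ) 1 → Y} (hγ : Continuous γ)
    (hinj : Function.Injective γ) (t : Ioo (0 : ℝ) 1) : γ t ∉ endpoints Y := by
  obtain ⟨t, ht₀, ht₁⟩ := t
  have sub (a b : ℝ) (ha : 0 < a) (hab : a ≤ b) (hb : b < 1) :
      IsSubcontinuum (γ '' {r | r.1 ∈ Icc a b}) := by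
    have hmem (r : Icc a b) : r.1 ∈ Ioo (0 : ℝ) 1 := ⟨ha.trans_le r.2.1, r.2.2.trans_lt hb⟩
    have hcont : Continuous fun r : Icc a b => γ ⟨r.1, hmem r⟩ :=
      hγ.comp (continuous_subtype_val.subtype_mk _)
    have heq : γ '' {r | r.1 ∈ Icc a b} = range fun r : Icc a b => γ ⟨r.1, hmem r⟩ := by
      ext y
      constructor
      · rintro ⟨r, hr, rfl⟩
        exact ⟨⟨r.1, hr⟩, rfl⟩
      · rintro ⟨r, rfl⟩
        exact ⟨_, r.2, rfl⟩
    have := Subtype.connectedSpace (isConnected_Icc hab)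
    rw [heq]
    exact ⟨isCompact_range hcont, isConnected_range hcont⟩
  intro h
  -- The subarcs on either side of t both contain `γ t`, but neither contains the other.
  rcases h _ _ (sub (t / 2) t (by linarith) (by linarith) ht₁)
    (sub t ((t + 1) / 2) ht₀ (by linarith) (by linarith))
    ⟨⟨t, ht₀, ht₁⟩, ⟨by simp only; linarith, le_rfl⟩, rfl⟩
    ⟨⟨t, ht₀, ht₁⟩, ⟨le_rfl, by simp only; linarith⟩, rfl⟩ with hsub | hsub
  · obtain ⟨r, hr, he⟩ := hsub
      ⟨⟨t / 2, by linarith, by linarith⟩, ⟨le_rfl, by simp only; linarith⟩, rfl⟩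
    rw [hinj he] at hr
    have := hr.1
    simp only at this
    linarith
  · obtain ⟨r, hr, he⟩ := hsub
      ⟨⟨(t + 1) / 2, by linarith, by linarith⟩, ⟨by simp only; linarith, le_rfl⟩, rfl⟩
    rw [hinj he] at hr
    have := hr.2
    simp only at this
    linarith

theorem endpoints_subset_wideFoldingPoints : endpoints Y ⊆ wideFoldingPoints Y := by
  rintro x hx ⟨U, hU, Z, _, -, -, -, ⟨h⟩⟩
  have hxe : x = (h.symm ((h ⟨x, mem_of_mem_nhds hU⟩).1, (h ⟨x, mem_of_mem_nhds hU⟩).2)).1 := by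
    simp
  rw [hxe] at hx
  refine not_mem_endpoints_of_arc (γ := fun r => (h.symm (_, r)).1) ?_ ?_ _ hx
  · fun_prop
  · intro r r' hr
    exact (Prod.ext_iff.1 (h.symm.injective (Subtype.ext hr))).2

end Arcs

theorem wideFoldingPoints_subset_foldingPoints {Y : Type} [TopologicalSpace Y] :
    wideFoldingPoints Y ⊆ foldingPoints Y := by
  rintro x hx ⟨U, hU, h⟩
  exact hx ⟨U, hU, ℕ → Bool, inferInstance, inferInstance, inferInstance, inferInstance, h⟩

theorem nonempty_Ioo_homeomorph {a b : ℝ} (hab : a < b) :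
    Nonempty (Ioo a b ≃ₜ Ioo (0 : ℝ) 1) := by
  have hba : b - a ≠ 0 := by linarith
  let e : ℝ ≃ₜ ℝ := affineHomeomorph (b - a) a hba
  refine ⟨((e.subtype (p := (· ∈ Ioo (0 : ℝ) 1)) (q := (· ∈ Ioo a b)) fun x => ?_)).symm⟩
  simp only [e, affineHomeomorph_apply, mem_Ioo]
  have : 0 < b - a := by linarith
  constructor
  · rintro ⟨h1, h2⟩
    constructor <;> nlinarith
  · rintro ⟨h1, h2⟩
    constructor <;> nlinarith

/-! ### Local product structure off the closed critical orbit -/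

section Itineraries

variable {s : ℝ}

/-- The two inverse branches of the tent map: left for `true`, right for `false`. -/
noncomputable def tentInv (s : ℝ) : Bool → ℝ → ℝ
  | true, y => y / s
  | false, y => 1 - y / s

/-- The backward orbit of `y` with prescribed inverse branches. -/
noncomputable def backwardPath (s : ℝ) (e : ℕ → Bool) (y : ℝ) : ℕ → ℝ
  | 0 => y
  | k + 1 => tentInv s (e k) (backwardPath s e y k)

theorem continuous_backwardPath (s : ℝ) (k : ℕ) :
    Continuous fun p : (ℕ → Bool) × ℝ => backwardPath s p.1 p.2 k := by
  induction k with
  | zero => exact continuous_snd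
  | succ k ih =>
    have h2 : Continuous fun q : Bool × ℝ => tentInv s q.1 q.2 := by
      rw [continuous_prod_of_discrete_left]
      rintro (_ | _)
      · exact continuous_const.sub (continuous_id.div_const s)
      · exact continuous_id.div_const s
    exact h2.comp (((continuous_apply k).comp continuous_fst).prodMk ih)

theorem tentMap_tentInv (hs : 0 < s) {y : ℝ} (hy : y ≤ s / 2) (b : Bool) :
    tentMap s (tentInv s b y) = y := by
  have h : y / s ≤ 1 / 2 := by rw [div_le_iff₀ hs]; linarith
  cases b
  · rw [tentInv, tentMap_of_ge hs.le (by linarith)]; field_simp; ring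
  · rw [tentInv, tentMap_of_le hs.le h]; field_simp

/-- The left preimage can leave the core only by falling below c₂, and the threshold s·c₂ is c₃. -/
theorem tentInv_true_mem_iff (hs : 1 ≤ s) {y : ℝ} (hy : y ∈ tentCore s) :
    tentInv s true y ∈ tentCore s ↔ s * (s * (1 - s / 2)) ≤ y := by
  have hs0 : 0 < s := by linarith
  rw [tentCore_eq hs] at *
  have : y / s ≤ s / 2 := by rw [div_le_iff₀ hs0]; nlinarith [hy.2]
  simp only [tentInv, mem_Icc, this, and_true, le_div_iff₀ hs0, mul_comm s]

theorem tentInv_false_mem (hs : 1 ≤ s) {y : ℝ} (hy : y ∈ tentCore s) :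
    tentInv s false y ∈ tentCore s := by
  have hs0 : 0 < s := by linarith
  rw [tentCore_eq hs] at *
  have h1 : y / s ≤ 1 / 2 := by rw [div_le_iff₀ hs0]; linarith [hy.2]
  have h2 : 1 - s / 2 ≤ y / s := by rw [le_div_iff₀ hs0]; linarith [hy.1]
  constructor
  · simp only [tentInv]; nlinarith [sq_nonneg (s - 1)]
  · simp only [tentInv]; linarith

theorem iterate_backwardPath (hs : 1 ≤ s) {e : ℕ → Bool} {y : ℝ} {k : ℕ}
    (h : ∀ j < k, backwardPath s e y j ∈ tentCore s) :
    (tentMap s)^[k] (backwardPath s e y k) = y := by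
  induction k with
  | zero => rfl
  | succ k ih =>
    have hk := h k (by omega)
    rw [tentCore_eq hs] at hk
    rw [Function.iterate_succ_apply, backwardPath, tentMap_tentInv (by linarith) hk.2]
    exact ih fun j hj => h j (by omega)

theorem critPt_iterate_three (hs : 1 ≤ s) :
    (tentMap s)^[3] critPt = s * (s * (1 - s / 2)) := by
  have hs0 : 0 ≤ s := by linarith
  simp only [Function.iterate_succ_apply, Function.iterate_zero_apply]
  rw [tentMap_critPt hs0, tentMap_of_ge (x := s / 2) hs0 (by linarith),
    tentMap_of_le hs0 (by nlinarith [sq_nonneg (s - 1)])]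

/-- Admissibility of an itinerary is constant on intervals that avoid the critical orbit. -/
theorem backwardPath_mem_of_mem (hs : 1 ≤ s) {e : ℕ → Bool} {V : Set ℝ} (hV : V.OrdConnected)
    (hVK : V ⊆ tentCore s) (hVc : ∀ n, (tentMap s)^[n] critPt ∉ V) {y : ℝ} (hy : y ∈ V)
    (he : ∀ k, backwardPath s e y k ∈ tentCore s) (k : ℕ) {t : ℝ} (ht : t ∈ V) :
    backwardPath s e t k ∈ tentCore s := by
  induction k using Nat.strong_induction_on generalizing t with
  | _ k ih =>
    rcases k with _ | k
    · exact hVK ht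
    have hek := he (k + 1)
    rw [backwardPath] at hek ⊢
    cases hb : e k
    · exact tentInv_false_mem hs (ih k (by omega) ht)
    · rw [hb, tentInv_true_mem_iff hs (he k)] at hek
      rw [tentInv_true_mem_iff hs (ih k (by omega) ht)]
      -- If admissibility changed between t and y, some r between them would have c₃ as its k-th
      -- backward point, so r = c_{k+3} would lie in `V`.
      by_contra! hlt
      have hcont : Continuous fun r => backwardPath s e r k :=
        (continuous_backwardPath s k).comp (Continuous.prodMk_right e)
      obtain ⟨r, hr, hrk⟩ :=
        intermediate_value_uIcc hcont.continuousOn (mem_uIcc.2 (.inl ⟨hlt.le, hek⟩))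
      have hrV : r ∈ V := hV.uIcc_subset ht hy hr
      refine hVc (k + 3) ?_
      simp only at hrk
      rwa [Function.iterate_add_apply, critPt_iterate_three hs, ← hrk,
        iterate_backwardPath hs fun j hj => ih j (by omega) hrV]

/-- The itineraries of the backward orbits of `y` that stay in the core. -/
def admissible (s y : ℝ) : Set (ℕ → Bool) := {e | ∀ k, backwardPath s e y k ∈ tentCore s}

theorem isClosed_admissible (s y : ℝ) : IsClosed (admissible s y) := by
  rw [admissible, ofPred_forall]
  exact isClosed_iInter fun k => isClosed_Icc.preimage
    ((continuous_backwardPath s k).comp (Continuous.prodMk_left y))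

instance (s y : ℝ) : CompactSpace (admissible s y) :=
  isCompact_iff_compactSpace.1 (isClosed_admissible s y).isCompact

/-- The itinerary of a point of the inverse limit, above level `i`. -/
noncomputable def itinerary (x : coreInverseLimit s) (i : ℕ) : ℕ → Bool :=
  fun k => decide (x.1 (i + k + 1) < 1 / 2)

theorem backwardPath_itinerary (hs : 1 ≤ s) (x : coreInverseLimit s) (i k : ℕ) :
    backwardPath s (itinerary x i) (x.1 i) k = x.1 (i + k) := by
  have hs0 : 0 < s := by linarith
  induction k with
  | zero => rfl
  | succ k ih =>
    have h := (x.2 (i + k)).2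
    rw [backwardPath, ih, itinerary, ← add_assoc]
    by_cases hlt : x.1 (i + k + 1) < 1 / 2
    · rw [decide_eq_true hlt, tentInv, ← h, tentMap_of_le hs0.le hlt.le]
      field_simp
    · rw [decide_eq_false hlt, tentInv, ← h, tentMap_of_ge hs0.le (not_lt.1 hlt)]
      field_simp
      ring

theorem itinerary_mem_admissible (hs : 1 ≤ s) (x : coreInverseLimit s) (i : ℕ) :
    itinerary x i ∈ admissible s (x.1 i) := fun k => by
  rw [backwardPath_itinerary hs]
  exact (x.2 _).1

theorem tentInv_lt_iff (hs : 0 < s) {y : ℝ} (hy : y < s / 2) (b : Bool) :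
    tentInv s b y < 1 / 2 ↔ b = true := by
  have : y / s < 1 / 2 := by rw [div_lt_iff₀ hs]; linarith
  cases b
  · simp only [tentInv, Bool.false_eq_true, iff_false]; linarith
  · simpa only [tentInv, iff_true] using this

/-- Away from the closure of the critical orbit, the inverse limit is locally the product of the
space of admissible itineraries and an open arc. -/
theorem exists_nhds_homeomorph_admissible (hs : 1 ≤ s) (hs₂ : s ≤ 2) {x : coreInverseLimit s} {i : ℕ}
    (hx : x.1 i ∉ postcriticalSet s) :
    ∃ U ∈ 𝓝 x, Nonempty (U ≃ₜ admissible s (x.1 i) × Ioo (0 : ℝ) 1) := by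
  have hs0 : 0 < s := by linarith
  obtain ⟨ε, hε, hball⟩ := Metric.isOpen_iff.1 isClosed_closure.isOpen_compl _ hx
  rw [Real.ball_eq_Ioo] at hball
  set a := x.1 i - ε
  set b := x.1 i + ε
  have hxV : x.1 i ∈ Ioo a b := ⟨by simp [a, hε], by simp [b, hε]⟩
  have hVc (n : ℕ) : (tentMap s)^[n] critPt ∉ Ioo a b := fun h =>
    hball h (iterate_critPt_mem_postcriticalSet s n)
  have hVK : Ioo a b ⊆ tentCore s := by
    intro t ht
    obtain ⟨h1, h2⟩ := (x.2 i).1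
    refine ⟨le_of_not_gt fun h => hVc 2 ?_, le_of_not_gt fun h => hVc 1 ?_⟩
    · exact ordConnected_Ioo.out ht hxV ⟨h.le, h1⟩
    · exact ordConnected_Ioo.out hxV ht ⟨h2, h.le⟩
  have hadm {y t : ℝ} (hy : y ∈ Ioo a b) (ht : t ∈ Ioo a b) {e : ℕ → Bool}
      (he : e ∈ admissible s y) : e ∈ admissible s t := fun k =>
    backwardPath_mem_of_mem hs ordConnected_Ioo hVK hVc hy he k ht
  let U : Set (coreInverseLimit s) := {y | y.1 i ∈ Ioo a b}
  obtain ⟨φ⟩ := nonempty_Ioo_homeomorph (show a < b by simp only [a, b]; linarith)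
  have hback {e : ℕ → Bool} {t : ℝ} (ht : t ∈ Ioo a b) (he : e ∈ admissible s t) (k : ℕ) :
      tentMap s (backwardPath s e t (k + 1)) = backwardPath s e t k := by
    have := he k
    rw [tentCore_eq hs] at this
    exact tentMap_tentInv hs0 this.2 _
  let toPt (p : admissible s (x.1 i) × Ioo a b) : coreInverseLimit s :=
    ⟨fun j => (tentMap s)^[i] (backwardPath s p.1 p.2 j), by
      have he := hadm hxV p.2.2 p.1.2
      have hb := hback p.2.2 he
      exact fun j => ⟨iterate_tentMap_mem_tentCore hs hs₂ (he j) i, iterate_backward_succ hb i j⟩⟩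
  have toPt_add (p) (k : ℕ) : (toPt p).1 (i + k) = backwardPath s p.1 p.2 k :=
    iterate_backward (hback p.2.2 (hadm hxV p.2.2 p.1.2)) i k
  have toPt_self (p) : (toPt p).1 i = p.2 := toPt_add p 0
  have htoPtU (p) : toPt p ∈ U := by
    change (toPt p).1 i ∈ Ioo a b
    rw [toPt_self]
    exact p.2.2
  have itinerary_toPt (p) : itinerary (toPt p) i = p.1 := by
    have he := hadm hxV p.2.2 p.1.2
    ext k
    have hk := he k
    rw [tentCore_eq hs] at hk
    -- At c₁ the two branches meet at c and the letter could not be recovered; but then the critical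
    -- orbit would hit the interval.
    have hne : backwardPath s p.1 p.2 k ≠ s / 2 := fun h => by
      have hiter := iterate_backwardPath hs (k := k) fun j _ => he j
      rw [h, ← tentMap_critPt hs0.le, ← Function.iterate_succ_apply] at hiter
      exact hVc (k + 1) (hiter ▸ p.2.2)
    have := tentInv_lt_iff hs0 (lt_of_le_of_ne hk.2 hne) (p.1.1 k)
    rw [itinerary, add_assoc, toPt_add, backwardPath]
    simp only [this, Bool.decide_eq_true]
  have toPt_itinerary (y : U) :
      toPt (⟨itinerary y.1 i, hadm y.2 hxV (itinerary_mem_admissible hs y.1 i)⟩,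
        ⟨y.1.1 i, y.2⟩) = y.1 := by
    ext j
    simp only [toPt, backwardPath_itinerary hs, iterate_tentMap_apply]
  have htoPt : Continuous toPt := by
    refine Continuous.subtype_mk (continuous_pi fun j => ?_) _
    refine ((continuous_tentMap s).iterate i).comp ((continuous_backwardPath s j).comp
      (g := fun p : (ℕ → Bool) × ℝ => backwardPath s p.1 p.2 j)
      (f := fun p : admissible s (x.1 i) × Ioo a b => (p.1.1, p.2.1)) ?_)
    fun_prop
  have hitin : Continuous fun y : U => itinerary y.1 i := by
    refine continuous_pi fun k => ?_
    have hc : Continuous fun y : U => y.1.1 (i + k + 1) :=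
      (continuous_coord _).comp continuous_subtype_val
    -- No deeper coordinate equals c, so `< 1/2` is a clopen condition and letters depend
    -- continuously on the point.
    have hne (y : U) : y.1.1 (i + k + 1) ≠ 1 / 2 := fun h => by
      have := iterate_tentMap_apply y.1 (k + 1) i
      rw [show k + 1 + i = i + k + 1 by ring, h] at this
      exact hVc (k + 1) (by rw [critPt, this]; exact y.2)
    rw [continuous_bool_rng true]
    have hset : (fun y : U => itinerary y.1 i k) ⁻¹' {true}
        = {y : U | y.1.1 (i + k + 1) < 1 / 2} := by
      ext y; simp [itinerary]
    have hset' : {y : U | y.1.1 (i + k + 1) < 1 / 2} = {y : U | y.1.1 (i + k + 1) ≤ 1 / 2} := by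
      ext y
      simp only [mem_ofPred_eq]
      exact ⟨le_of_lt, fun h => lt_of_le_of_ne h (hne y)⟩
    rw [hset]
    exact ⟨hset' ▸ isClosed_le hc continuous_const, isOpen_lt hc continuous_const⟩
  refine ⟨U, (isOpen_Ioo.preimage (continuous_coord i)).mem_nhds hxV, ⟨Homeomorph.trans
    { toFun := fun y => (⟨itinerary y.1 i, hadm y.2 hxV (itinerary_mem_admissible hs y.1 i)⟩,
        ⟨y.1.1 i, y.2⟩)
      invFun := fun p => ⟨toPt p, htoPtU p⟩
      left_inv := fun y => Subtype.ext (toPt_itinerary y)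
      right_inv := fun p => Prod.ext (Subtype.ext (itinerary_toPt p)) (Subtype.ext (toPt_self p))
      continuous_toFun := (hitin.subtype_mk _).prodMk
        (((continuous_coord i).comp continuous_subtype_val).subtype_mk _)
      continuous_invFun := htoPt.subtype_mk htoPtU } ((Homeomorph.refl _).prodCongr φ)⟩⟩

end Itineraries

/-! ### For s > √2 the admissible itineraries form a Cantor set -/

section Cantor

variable {s y : ℝ}

/-- Both preimages of `t` lie in the core if and only if `c₃ ≤ t`. -/
def Branching (s t : ℝ) : Prop := s * (s * (1 - s / 2)) ≤ t

theorem mem_admissible_iff (hs : 1 ≤ s) (hy : y ∈ tentCore s) {e : ℕ → Bool} :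
    e ∈ admissible s y ↔ ∀ k, e k = true → Branching s (backwardPath s e y k) := by
  constructor
  · intro h k hk
    have := h (k + 1)
    rwa [backwardPath, hk, tentInv_true_mem_iff hs (h k)] at this
  · intro h k
    induction k with
    | zero => exact hy
    | succ k ih =>
      rw [backwardPath]
      cases hb : e k
      · exact tentInv_false_mem hs ih
      · exact (tentInv_true_mem_iff hs ih).2 (h k hb)

/-- Below c₃ only the right branch is allowed, and it leads above 1 - c₂. This is at least c₃ = s·c₂
because (s - 1)(s² - 2) > 0, so of any two consecutive times at least one branches. -/
theorem infinite_branching (hs : √2 < s) {e : ℕ → Bool} (he : e ∈ admissible s y) :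
    {k | Branching s (backwardPath s e y k)}.Infinite := by
  have hs2 : 2 < s ^ 2 := (Real.sqrt_lt' (by have := Real.sqrt_nonneg 2; linarith)).1 hs
  have hs1 : 1 < s := by have := Real.sqrt_nonneg 2; nlinarith
  rw [← Nat.frequently_atTop_iff_infinite, frequently_atTop]
  intro k
  by_cases hk : Branching s (backwardPath s e y k)
  · exact ⟨k, le_rfl, hk⟩
  · refine ⟨k + 1, by omega, ?_⟩
    have hek : e k = false := by
      by_contra h
      exact hk ((mem_admissible_iff hs1.le (he 0)).1 he k (by simpa using h))
    rw [Branching, not_le] at hk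
    rw [Branching, backwardPath, hek, tentInv]
    have : backwardPath s e y k / s ≤ s * (1 - s / 2) := by
      rw [div_le_iff₀ (by linarith)]; linarith
    nlinarith [mul_pos (sub_pos.2 hs1) (sub_pos.2 hs2)]

open Classical in
/-- Follow inverse branches from `y`, taking the next unused letter of `a` where there is a choice.
The state records the current point and the number of letters used. -/
noncomputable def choiceState (s y : ℝ) (a : ℕ → Bool) : ℕ → ℝ × ℕ
  | 0 => (y, 0)
  | k + 1 =>
    if Branching s (choiceState s y a k).1 then
      (tentInv s (a (choiceState s y a k).2) (choiceState s y a k).1, (choiceState s y a k).2 + 1)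
    else (tentInv s false (choiceState s y a k).1, (choiceState s y a k).2)

open Classical in
/-- The itinerary obtained by following the choices `a`. -/
noncomputable def choiceItinerary (s y : ℝ) (a : ℕ → Bool) (k : ℕ) : Bool :=
  if Branching s (choiceState s y a k).1 then a (choiceState s y a k).2 else false

open Classical in
theorem choiceState_eq (s y : ℝ) (a : ℕ → Bool) (k : ℕ) :
    choiceState s y a k = (backwardPath s (choiceItinerary s y a) y k,
      Nat.count (fun i => Branching s (backwardPath s (choiceItinerary s y a) y i)) k) := by
  induction k with
  | zero => simp [choiceState, backwardPath]
  | succ k ih =>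
    have h1 : (choiceState s y a k).1 = backwardPath s (choiceItinerary s y a) y k := by rw [ih]
    have h2 : (choiceState s y a k).2 = Nat.count _ k := congrArg Prod.snd ih
    have h3 : choiceItinerary s y a k =
      if Branching s (choiceState s y a k).1 then a (choiceState s y a k).2 else false := rfl
    rw [choiceState, backwardPath, Nat.count_succ, ← h1, ← h2, h3]
    by_cases hb : Branching s (choiceState s y a k).1 <;> simp [hb]

theorem choiceItinerary_mem_admissible (hs : 1 ≤ s) (hy : y ∈ tentCore s) (a : ℕ → Bool) :
    choiceItinerary s y a ∈ admissible s y := by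
  rw [mem_admissible_iff hs hy]
  intro k hk
  by_contra hb
  rw [choiceItinerary, choiceState_eq, if_neg hb] at hk
  exact absurd hk (by simp)

theorem eventually_apply_eq (a : ℕ → Bool) (j : ℕ) : ∀ᶠ a' in 𝓝 a, a' j = a j :=
  ((continuous_apply j).tendsto a).eventually (p := fun b => b = a j) (by simp)

theorem eventually_choiceState_eq (a : ℕ → Bool) (k : ℕ) :
    ∀ᶠ a' in 𝓝 a, choiceState s y a' k = choiceState s y a k := by
  induction k with
  | zero => exact Eventually.of_forall fun _ => rfl
  | succ k ih =>
    have h : ∀ᶠ a' in 𝓝 a, a' (choiceState s y a k).2 = a (choiceState s y a k).2 :=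
    eventually_apply_eq a _
    filter_upwards [ih, h] with a' h1 h2
    rw [choiceState, choiceState, h1, h2]

theorem continuous_choiceItinerary : Continuous (choiceItinerary s y) := by
  refine continuous_pi fun k => IsLocallyConstant.continuous ?_
  rw [IsLocallyConstant.iff_eventually_eq]
  intro a
  have h : ∀ᶠ a' in 𝓝 a, a' (choiceState s y a k).2 = a (choiceState s y a k).2 :=
    eventually_apply_eq a _
  filter_upwards [eventually_choiceState_eq (s := s) (y := y) a k, h] with a' h1 h2
  rw [choiceItinerary, choiceItinerary, h1, h2]

/-- The letter a_j reappears at the j-th branching time, which exists because branching never stops.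
-/
theorem injective_choiceItinerary (hs : √2 < s) (hs₁ : 1 ≤ s) (hy : y ∈ tentCore s) :
    Function.Injective (choiceItinerary s y) := by
  classical
  have key (a : ℕ → Bool) (j : ℕ) : choiceItinerary s y a
      (Nat.nth (fun i => Branching s (backwardPath s (choiceItinerary s y a) y i)) j) = a j := by
    have hinf := infinite_branching hs (choiceItinerary_mem_admissible hs₁ hy a)
    rw [choiceItinerary, choiceState_eq, if_pos (Nat.nth_mem_of_infinite hinf j),
      Nat.count_nth_of_infinite hinf]
  intro a a' h
  ext j
  rw [← key a j, ← key a' j, h]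

/-- Reading e at its branching times recovers the choices; at all other times the letter is forced.
-/
theorem exists_choiceItinerary_eq (hs : 1 ≤ s) (hy : y ∈ tentCore s) {e : ℕ → Bool}
    (he : e ∈ admissible s y) : ∃ a, choiceItinerary s y a = e := by
  classical
  rw [mem_admissible_iff hs hy] at he
  set p : ℕ → Prop := fun i => Branching s (backwardPath s e y i) with hp
  have hfalse {k : ℕ} (hk : ¬ p k) : e k = false := by
    by_contra h
    exact hk (he k (by simpa using h))
  let a : ℕ → Bool := fun j => e (Nat.nth p j)
  have ha {k : ℕ} (hk : p k) : a (Nat.count p k) = e k := by simp only [a, Nat.nth_count hk]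
  have key (k : ℕ) : choiceState s y a k = (backwardPath s e y k, Nat.count p k) := by
    induction k with
    | zero => simp [choiceState, backwardPath]
    | succ k ih =>
      rw [choiceState, ih, Nat.count_succ, backwardPath]
      by_cases hk : p k
      · rw [if_pos hk, if_pos hk, ha hk]
      · rw [if_neg hk, if_neg hk, hfalse hk, add_zero]
  refine ⟨a, funext fun k => ?_⟩
  rw [choiceItinerary, key]
  by_cases hk : p k
  · rw [if_pos hk, ha hk]
  · rw [if_neg hk, hfalse hk]

theorem nonempty_admissible_homeomorph (hs : √2 < s) (hs₁ : 1 ≤ s) (hy : y ∈ tentCore s) :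
    Nonempty (admissible s y ≃ₜ (ℕ → Bool)) := by
  let f : (ℕ → Bool) → admissible s y :=
    fun a => ⟨choiceItinerary s y a, choiceItinerary_mem_admissible hs₁ hy a⟩
  have hf : Continuous f := continuous_choiceItinerary.subtype_mk _
  have hbij : Function.Bijective f := by
    constructor
    · intro a a' h
      exact injective_choiceItinerary hs hs₁ hy (congrArg Subtype.val h)
    · rintro ⟨e, he⟩
      obtain ⟨a, ha⟩ := exists_choiceItinerary_eq hs₁ hy he
      exact ⟨a, Subtype.ext ha⟩
  exact ⟨(Continuous.homeoOfEquivCompactToT2 (f := Equiv.ofBijective f hbij) hf).symm⟩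

end Cantor

/-! ### Folding points lie in the postcritical limit; conclusion -/

theorem wideFoldingPoints_subset_postcriticalLimit {s : ℝ} (hs₁ : 1 ≤ s) (hs₂ : s ≤ 2) :
    wideFoldingPoints (coreInverseLimit s) ⊆ postcriticalLimit s := by
  intro x hx i
  by_contra hi
  obtain ⟨U, hU, h⟩ := exists_nhds_homeomorph_admissible hs₁ hs₂ hi
  exact hx ⟨U, hU, _, _, inferInstance, inferInstance, inferInstance, h⟩

theorem foldingPoints_subset_postcriticalLimit {s : ℝ} (hs : √2 < s) (hs₁ : 1 ≤ s)
    (hs₂ : s ≤ 2) : foldingPoints (coreInverseLimit s) ⊆ postcriticalLimit s := by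
  intro x hx i
  by_contra hi
  obtain ⟨U, hU, ⟨h⟩⟩ := exists_nhds_homeomorph_admissible hs₁ hs₂ hi
  obtain ⟨φ⟩ := nonempty_admissible_homeomorph hs hs₁ (x.2 i).1
  exact hx ⟨U, hU, ⟨h.trans (φ.prodCongr (Homeomorph.refl _))⟩⟩

theorem proposition4p5 (s : ℝ) (hs₁ : 1 < s) (hs₂ : s ≤ 2)
    (hinf : (forwardOrbit (tentMap s) critPt).Infinite)
    (hrec : IsRecurrentPt (tentMap s) critPt) :
    ¬ (endpoints (coreInverseLimit s)).Countable ∧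
    Preperfect (endpoints (coreInverseLimit s)) ∧
    (endpoints (coreInverseLimit s) ⊆ wideFoldingPoints (coreInverseLimit s) ∧
      wideFoldingPoints (coreInverseLimit s) ⊆ closure (endpoints (coreInverseLimit s))) ∧
    (Real.sqrt 2 < s →
      endpoints (coreInverseLimit s) ⊆ foldingPoints (coreInverseLimit s) ∧
      foldingPoints (coreInverseLimit s) ⊆ closure (endpoints (coreInverseLimit s))) := by
  have hdiff {C : Set (coreInverseLimit s)} (hC : C.Countable) :=
    postcriticalLimit_subset_closure_endpoints_diff hs₁.le hs₂ hinf hrec hC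
  have hdense : postcriticalLimit s ⊆ closure (endpoints (coreInverseLimit s)) := by
    simpa using hdiff countable_empty
  have hEF := endpoints_subset_wideFoldingPoints (Y := coreInverseLimit s)
  have hFL := wideFoldingPoints_subset_postcriticalLimit hs₁.le hs₂
  -- Deleting all endpoints, if countable, would leave the closure of ∅, yet L is nonempty; deleting
  -- only x shows that x is not isolated.
  refine ⟨fun hE => ?_, fun x hx => ?_, ⟨hEF, hFL.trans hdense⟩, fun hs => ?_⟩
  · obtain ⟨x, hx, -⟩ :=
      exists_mem_postcriticalLimit hs₁.le hs₂ hrec (critPt_mem_postcriticalSet s) 0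
    simpa using hdiff hE hx
  · rw [accPt_principal_iff_clusterPt, ← mem_closure_iff_clusterPt]
    exact hdiff (countable_singleton x) (hFL (hEF hx))
  · exact ⟨hEF.trans wideFoldingPoints_subset_foldingPoints,
      (foldingPoints_subset_postcriticalLimit hs hs₁.le hs₂).trans hdense⟩
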